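/- Let $(W,\mathcal S)$ be a Coxeter system and $V$ a (finite-dimensional) realization of it over a field $\Bbbk$ that is faithful, reflection faithful and balanced and satisfies generalized Demazure surjectivity (for every finitary $I\subset\mathcal S$, i.e. $W_I$ finite, the operator $\partial_{w_I}\colon R\to R^I$ is surjective, where $w_I$ is the longest element of $W_I$). Here $R=\operatorname{Sym}(V)$, $R^I=R^{W_I}$, $\partial_w$ denotes the Demazure operators, and for finitary $I\subset J$ the Frobenius trace is $\partial^I_J=\partial_{w_Jw_I^{-1}}\colon R^I\to R^J$. Let $\mathbf{Frob}$ be the strict $\Bbbk$-linear diagrammatic 2-category (Elias--Snyder--Williamson) attached to the cube of Frobenius extensions $(R^J\subset R^I)_{I\subset J\text{ finitary}}$. Its objects are the finitary subsets; its 1-morphisms are the singlestep expressions, in which each step is $+s$ (from $I$ to $Is$) or $-s$ (from $Is$ to $I$); its 2-morphisms are generated by oriented cups and caps, up-facing crossings, and polynomials $f\in R^I$ placed in regions labelled $I$, subject to isotopy, addition, multiplication and sliding of polynomials, the circle evaluations, the idempotent decomposition, and the easy and hard Reidemeister II and III relations. For an expression $E$ from $I$ to $J$ let $\partial_E\colon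 R^J\to R^I$ be the composition of the inclusions $R^{Ks}\hookrightarrow R^{K}$ (one for each step $+s$ from $K$ to $Ks$) and of the traces $\partial^{K}_{Ks}\colon R^{K}\to R^{Ks}$ (one for each step $-s$ from $Ks$ to $K$). Let $S\subset\mathcal S$ be finitary (for instance $S=\mathcal S$ when $W$ is finite), let $d\ge 2$, and let $u_0,\dots,u_d\in S$ with $u_i\ne u_{i+1}$ for $0\le i\le d-1$. Put $\widehat{u}=S\setminus\{u\}$, $I=\widehat{u_0}$, $M=S\setminus\{u_{d-1},u_d\}$, and consider the expressions $$K_\bullet=[I+u_0-u_d],\qquad L'_\bullet=[I-u_1+u_0-u_2+u_1-\cdots-u_d],\qquad L_\bullet=L'_\bullet\circ[+u_{d-1}].$$ Let $b\colon K_\bullet\to L_\bullet$ be the diagram in which the strands $+u_0$ and $-u_d$ run from bottom to top, each of the colours $u_1,\dots,u_{d-1}$ contributes one counterclockwise cup, and for $0\le i\le d-1$ the strands $+u_i$ and $-u_{i+1}$ cross exactly once (in a right-facing crossing, bounding the region $S\setminus\{u_i,u_{i+1}\}$). Let $t\colon L_\bullet\to K_\bullet$ be its dual, i.e. the same diagram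 flipped upside down with all orientations reversed. For $g\in R^M$ let $\operatorname{Circ}(g)=t\circ(\mathrm{id}_{L'_\bullet}\otimes g\otimes \mathrm{id}_{+u_{d-1}})\circ b$, an endomorphism of $K_\bullet$ in $\mathbf{Frob}$: the chain of $d-1$ overlapping counterclockwise circles coloured $u_1,\dots,u_{d-1}$ between the two vertical strands, with $g$ in the region $M$. Then for every $g\in R^M$, $$\operatorname{Circ}(g)=\partial_{L'_\bullet}\bigl(g\,\Delta_{(1)}\bigr)\otimes\mathrm{id}_{K_\bullet}\otimes\Delta_{(2)}\qquad\text{in }\operatorname{End}_{\mathbf{Frob}}(K_\bullet),$$ where $\Delta=\Delta_{(1)}\otimes\Delta_{(2)}\in R^{\widehat{u_d}}\otimes_{R^S}R^{\widehat{u_d}}$ is the coproduct element. Explicitly: for every pair of dual bases $(c_i)_i,(d_i)_i$ of $R^{\widehat{u_d}}$ over $R^S$, that is, bases with $\partial^{\widehat{u_d}}_S(c_id_j)=\delta_{ij}$, one has $$\operatorname{Circ}(g)=\sum_i \partial_{L'_\bullet}(g\,c_i)\otimes\mathrm{id}_{K_\bullet}\otimes d_i ,$$ where $c_i$ is viewed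 in $R^M$ and a polynomial written on the left (right) of $\mathrm{id}_{K_\bullet}$ is placed in the leftmost region $\widehat{u_0}$ (rightmost region $\widehat{u_d}$). -/

import Mathlib

namespace SoergelCalculus

noncomputable section

universe uB uW uk uV

/-! ## Finitary subsets, realizations, invariants and Demazure operators -/

section Coxeter

variable {B : Type uB} {W : Type uW} [Group W] {M : CoxeterMatrix B}

/-- The standard parabolic subgroup `W_I` generated by the simple reflections in `I`. -/
def parabolic (cs : CoxeterSystem M W) (I : Set B) : Subgroup W :=
  Subgroup.closure (cs.simple '' I)

theorem parabolic_mono (cs : CoxeterSystem M W) {I J : Set B} (h : I ⊆ J) :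
    parabolic cs I ≤ parabolic cs J :=
  Subgroup.closure_mono (Set.image_mono h)

/-- A finitary subset: a set `I` of simple reflections with `W_I` finite.
These are the objects of the 2-category `Frob`. -/
structure FinSub (cs : CoxeterSystem M W) where
  carrier : Set B
  finitary : (parabolic cs carrier : Set W).Finite

theorem exists_longest (cs : CoxeterSystem M W) (I : FinSub cs) :
    ∃ w ∈ parabolic cs I.carrier, ∀ v ∈ parabolic cs I.carrier, cs.length v ≤ cs.length w := by
  obtain ⟨w, hw, h⟩ := Set.exists_max_image (parabolic cs I.carrier : Set W) cs.length
    I.finitary ⟨1, (parabolic cs I.carrier).one_mem⟩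
  exact ⟨w, hw, h⟩

/-- The longest element `w_I` of the finite parabolic subgroup `W_I`. -/
def longest (cs : CoxeterSystem M W) (I : FinSub cs) : W :=
  (exists_longest cs I).choose

/-- The two-coloured quantum numbers `[n]_x` in the variables `x = [2]_x` and `y = [2]_y`;
`[n]_y` is obtained by exchanging the two variables. -/
def qnum {k : Type uk} [CommRing k] (x y : k) : ℕ → k
  | 0 => 0
  | 1 => 1
  | n + 2 => x * qnum y x (n + 1) - qnum x y n

/-- A realization of the Coxeter system over `k`: simple roots `α_s ∈ V` and simple coroots
`α_s^∨ ∈ V^*` with `⟨α_s^∨, α_s⟩ = 2`, such that `s(v) = v - ⟨α_s^∨, v⟩ α_s` defines a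
representation of `W`, together with the technical condition `[m_st]_x = [m_st]_y = 0`
(imposed for every ordered pair `(s, t)`) whenever `m_st` is finite.
In Mathlib's Coxeter matrices the value `0` stands for `m_st = ∞`. -/
structure Realization (cs : CoxeterSystem M W) (k : Type uk) (V : Type uV) [Field k]
    [AddCommGroup V] [Module k V] where
  root : B → V
  coroot : B → Module.Dual k V
  coroot_root : ∀ s, coroot s (root s) = 2
  rep : Representation k W V
  rep_simple : ∀ s v, rep (cs.simple s) v = v - coroot s v • root s
  qnum_eq_zero : ∀ s t, s ≠ t → M s t ≠ 0 →
    qnum (-(coroot s (root t))) (-(coroot t (root s))) (M s t) = 0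

namespace Realization

variable {cs : CoxeterSystem M W} {k : Type uk} {V : Type uV} [Field k]
  [AddCommGroup V] [Module k V] (ρ : Realization cs k V)

/-- Balanced: `[m_st - 1]_x = [m_st - 1]_y = 1` whenever `m_st` is finite. -/
def Balanced : Prop :=
  ∀ s t, s ≠ t → M s t ≠ 0 →
    qnum (-(ρ.coroot s (ρ.root t))) (-(ρ.coroot t (ρ.root s))) (M s t - 1) = 1

/-- The representation `V` of `W` is faithful. -/
def Faithful : Prop := Function.Injective ρ.rep

/-- Reflection faithful: faithful, and the elements of `W` whose fixed space has codimension
one are exactly the reflections. -/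
def ReflectionFaithful : Prop :=
  ρ.Faithful ∧ ∀ w : W,
    Module.finrank k V = Module.finrank k (LinearMap.ker (ρ.rep w - LinearMap.id)) + 1 ↔
      cs.IsReflection w

/-- The action of `w ∈ W` on `R = Sym(V)` by algebra automorphisms. -/
def act (w : W) : SymmetricAlgebra k V →ₐ[k] SymmetricAlgebra k V :=
  SymmetricAlgebra.lift (SymmetricAlgebra.ι k V ∘ₗ ρ.rep w)

/-- The invariant subring `R^I` of `W_I`-invariant polynomials. -/
def inv (I : FinSub cs) : Subalgebra k (SymmetricAlgebra k V) where
  carrier := {f | ∀ w ∈ parabolic cs I.carrier, ρ.act w f = f}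
  mul_mem' := fun {a b} ha hb w hw => by rw [map_mul, ha w hw, hb w hw]
  add_mem' := fun {a b} ha hb w hw => by rw [map_add, ha w hw, hb w hw]
  algebraMap_mem' := fun r w _ => (ρ.act w).commutes r

theorem inv_anti {I J : FinSub cs} (h : I.carrier ⊆ J.carrier) : ρ.inv J ≤ ρ.inv I :=
  fun _ hf w hw => hf w (parabolic_mono cs h hw)

/-- `f - s(f)` is divisible by `α_s`. -/
theorem exists_demazure (s : B) (f : SymmetricAlgebra k V) :
    ∃ g, SymmetricAlgebra.ι k V (ρ.root s) * g = f - ρ.act (cs.simple s) f := by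
  let a := SymmetricAlgebra.ι k V (ρ.root s)
  let q := Ideal.Quotient.mkₐ k (Ideal.span {a})
  have h : q = q.comp (ρ.act (cs.simple s)) := by
    apply SymmetricAlgebra.algHom_ext
    ext v
    have ha : q a = 0 :=
      Ideal.Quotient.eq_zero_iff_mem.mpr (Ideal.subset_span rfl)
    simp [act, ρ.rep_simple, map_sub, map_smul, show q (SymmetricAlgebra.ι k V (ρ.root s)) = 0
      from ha]
  have h2 : q (f - ρ.act (cs.simple s) f) = 0 := by
    rw [map_sub, sub_eq_zero]
    exact DFunLike.congr_fun h f
  obtain ⟨g, hg⟩ := Ideal.mem_span_singleton.mp (Ideal.Quotient.eq_zero_iff_mem.mp h2)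
  exact ⟨g, hg.symm⟩

/-- The simple Demazure operator `∂_s(f) = (f - s(f)) / α_s`. -/
def demazure (s : B) (f : SymmetricAlgebra k V) : SymmetricAlgebra k V :=
  (ρ.exists_demazure s f).choose

/-- The Demazure operator `∂_w = ∂_{s_1} ∘ ⋯ ∘ ∂_{s_m}`, for a reduced word `s_1 ⋯ s_m` of `w`. -/
def demazureOp (w : W) (f : SymmetricAlgebra k V) : SymmetricAlgebra k V :=
  (cs.exists_isReduced w).choose.foldr ρ.demazure f

/-- Generalized Demazure surjectivity: for every finitary `I` the operator
`∂_{w_I} : R → R^I` is surjective. -/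
def GeneralizedDemazureSurjectivity : Prop :=
  ∀ (I : FinSub cs), ∀ f ∈ ρ.inv I, ∃ p, ρ.demazureOp (longest cs I) p = f

open Classical in
/-- The Frobenius trace `∂^I_J = ∂_{w_J w_I⁻¹} : R^I → R^J` for `I ⊆ J`.
(This operator does map `R^I` to `R^J`; the alternative value `0` is never taken.) -/
def trace (I J : FinSub cs) (f : ρ.inv I) : ρ.inv J :=
  if h : ρ.demazureOp (longest cs J * (longest cs I)⁻¹) f ∈ ρ.inv J then
    ⟨ρ.demazureOp (longest cs J * (longest cs I)⁻¹) f, h⟩ else 0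

/-- The family `c` is a basis of `R^I` as a module over `R^J` (for `I ⊆ J`). -/
def IsBasisOver (I J : FinSub cs) {n : ℕ} (c : Fin n → ρ.inv I) : Prop :=
  ∀ f : ρ.inv I, ∃! r : Fin n → ρ.inv J,
    (f : SymmetricAlgebra k V) = ∑ i, (r i : SymmetricAlgebra k V) * (c i : SymmetricAlgebra k V)

/-- `c` and `d` are dual bases of the Frobenius extension `R^J ⊆ R^I`, so that
`Δ^I_J = ∑ i, c i ⊗ d i` is its coproduct element. -/
structure IsDualBases (I J : FinSub cs) {n : ℕ} (c d : Fin n → ρ.inv I) : Prop where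
  left : ρ.IsBasisOver I J c
  right : ρ.IsBasisOver I J d
  pairing : ∀ i j, ρ.trace I J (c i * d j) = if i = j then 1 else 0

/-- The set `Φ⁺_I` of positive roots `w(α_s)`, for `w ∈ W_I` and `s ∈ I`; the root `w(α_s)` is
positive when `ℓ(ws) > ℓ(w)`. -/
def posRoots (I : FinSub cs) : Set V :=
  {v | ∃ w ∈ parabolic cs I.carrier, ∃ s ∈ I.carrier,
    cs.length w < cs.length (w * cs.simple s) ∧ v = ρ.rep w (ρ.root s)}

/-- The product in `R` of a (finite) set of roots. -/
def rootProd (X : Set V) : SymmetricAlgebra k V :=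
  ∏ᶠ v ∈ X, SymmetricAlgebra.ι k V v

end Realization

end Coxeter

/-! ## Singlestep expressions -/

section Expressions

variable {B : Type uB} {W : Type uW} [Group W] {M : CoxeterMatrix B} {cs : CoxeterSystem M W}

/-- `J = I ⊔ {s}`. -/
structure IsAdd (I J : FinSub cs) (s : B) : Prop where
  notMem : s ∉ I.carrier
  eq : J.carrier = insert s I.carrier

theorem IsAdd.subset {I J : FinSub cs} {s : B} (h : IsAdd I J s) : I.carrier ⊆ J.carrier := by
  rw [h.eq]; exact Set.subset_insert _ _

/-- One step of a singlestep expression: `+s` from `I` to `Is`, or `-s` from `Is` to `I`. -/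
inductive Step : FinSub cs → FinSub cs → Type uB
  | up {I J : FinSub cs} (s : B) (h : IsAdd I J s) : Step I J
  | down {I J : FinSub cs} (s : B) (h : IsAdd I J s) : Step J I

instance : Quiver (FinSub cs) := ⟨Step⟩

/-- Singlestep expressions from `I` to `J`: the 1-morphisms of `Frob`. -/
abbrev Expr (I J : FinSub cs) : Type uB := Quiver.Path I J

/-- The empty expression. -/
abbrev nil (I : FinSub cs) : Expr I I := Quiver.Path.nil

/-- The expression `[I + s]`. -/
abbrev up {I J : FinSub cs} {s : B} (h : IsAdd I J s) : Expr I J :=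
  Quiver.Path.cons Quiver.Path.nil (Step.up s h)

/-- The expression `[Is - s]`. -/
abbrev dn {I J : FinSub cs} {s : B} (h : IsAdd I J s) : Expr J I :=
  Quiver.Path.cons Quiver.Path.nil (Step.down s h)

/-- Concatenation of expressions. -/
local infixl:75 " ⬝ " => Quiver.Path.comp

/-- A square `I ⊂ Is, It ⊂ Ist`, with `A = Is`, `C = It` and `D = Ist`. -/
structure Square (I A C D : FinSub cs) (s t : B) : Prop where
  ia : IsAdd I A s
  ic : IsAdd I C t
  ad : IsAdd A D t
  cd : IsAdd C D s

theorem Square.symm {I A C D : FinSub cs} {s t : B} (q : Square I A C D s t) :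
    Square I C A D t s := ⟨q.ic, q.ia, q.cd, q.ad⟩

/-- A cube, with `A = Is`, `C = It`, `E = Iu`, `AC = Ist`, `AE = Isu`, `CE = Itu`, `D = Istu`. -/
structure Cube (I A C E AC AE CE D : FinSub cs) (s t u : B) : Prop where
  st : Square I A C AC s t
  su : Square I A E AE s u
  tu : Square I C E CE t u
  overA : Square A AC AE D t u
  overC : Square C AC CE D s u
  overE : Square E AE CE D s t

/-! ## Demazure operators of expressions -/

variable {k : Type uk} {V : Type uV} [Field k] [AddCommGroup V] [Module k V]

/-- The inclusion `R^J → R^I` for `J = Is`. -/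
def incl (ρ : Realization cs k V) {I J : FinSub cs} {s : B} (h : IsAdd I J s) (f : ρ.inv J) :
    ρ.inv I := Subalgebra.inclusion (ρ.inv_anti h.subset) f

/-- For a single step `[I, J]` the map `R^J → R^I`: the inclusion for `[I + s]`, the trace map
for `[Is - s]`. -/
def stepOp (ρ : Realization cs k V) : {I J : FinSub cs} → Step I J → ρ.inv J → ρ.inv I
  | _, _, Step.up _ h => incl ρ h
  | I, J, Step.down _ _ => ρ.trace J I

/-- `∂_{L} : R^J → R^I` for an expression `L` from `I` to `J`: the iterated composition of
inclusion maps and trace maps. -/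
def exprOp (ρ : Realization cs k V) {I : FinSub cs} : {J : FinSub cs} → Expr I J →
    ρ.inv J → ρ.inv I
  | _, Quiver.Path.nil => id
  | _, Quiver.Path.cons p e => fun f => exprOp ρ p (stepOp ρ e f)

/-! ## The 2-category `Frob` -/

/-- Formal `k`-linear combinations of formal composites of the generating 2-morphisms. The
generators are the cups and caps, the up-facing crossings and the polynomials. -/
inductive Diag (ρ : Realization cs k V) :
    {I J : FinSub cs} → Expr I J → Expr I J → Type (max uB uk uV)
  /-- identity 2-morphism -/
  | id {I J : FinSub cs} (p : Expr I J) : Diag ρ p p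
  /-- vertical composition, the first argument at the bottom -/
  | vcomp {I J : FinSub cs} {p q r : Expr I J} : Diag ρ p q → Diag ρ q r → Diag ρ p r
  /-- horizontal composition, the first argument on the left -/
  | hcomp {I J K : FinSub cs} {p q : Expr I J} {p' q' : Expr J K} :
      Diag ρ p q → Diag ρ p' q' → Diag ρ (p ⬝ p') (q ⬝ q')
  | zero {I J : FinSub cs} (p q : Expr I J) : Diag ρ p q
  | add {I J : FinSub cs} {p q : Expr I J} : Diag ρ p q → Diag ρ p q → Diag ρ p q
  | smul {I J : FinSub cs} {p q : Expr I J} : k → Diag ρ p q → Diag ρ p q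
  /-- counterclockwise cup `ι : [Is] → [Is, I, Is]` -/
  | ccwCup {I J : FinSub cs} {s : B} (h : IsAdd I J s) : Diag ρ (nil J) (dn h ⬝ up h)
  /-- counterclockwise cap `∂ : [Is, I, Is] → [Is]` -/
  | ccwCap {I J : FinSub cs} {s : B} (h : IsAdd I J s) : Diag ρ (dn h ⬝ up h) (nil J)
  /-- clockwise cup `Δ : [I] → [I, Is, I]` -/
  | cwCup {I J : FinSub cs} {s : B} (h : IsAdd I J s) : Diag ρ (nil I) (up h ⬝ dn h)
  /-- clockwise cap `m : [I, Is, I] → [I]` -/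
  | cwCap {I J : FinSub cs} {s : B} (h : IsAdd I J s) : Diag ρ (up h ⬝ dn h) (nil I)
  /-- up-facing crossing `[I, It, Ist] → [I, Is, Ist]` -/
  | cross {I A C D : FinSub cs} {s t : B} (q : Square I A C D s t) :
      Diag ρ (up q.ic ⬝ up q.cd) (up q.ia ⬝ up q.ad)
  /-- the polynomial `f ∈ R^I` in a region labelled `I` -/
  | poly {I : FinSub cs} (f : ρ.inv I) : Diag ρ (nil I) (nil I)

variable (ρ : Realization cs k V)

/-- Vertical composition, read from bottom to top. -/
local notation:60 a:60 " ⊚ " b:61 =>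
  (Diag.vcomp (ρ := ρ) (a : Diag ρ _ _) (b : Diag ρ _ _) : Diag ρ _ _)

/-- Horizontal composition, read from left to right. -/
local notation:70 a:70 " ⊠ " b:71 =>
  (Diag.hcomp (ρ := ρ) (a : Diag ρ _ _) (b : Diag ρ _ _) : Diag ρ _ _)

namespace Diag

/-- Finite sums. -/
def sum {ρ : Realization cs k V} {I J : FinSub cs} {p q : Expr I J} {n : ℕ}
    (f : Fin n → Diag ρ p q) : Diag ρ p q :=
  (List.ofFn f).foldr add (zero p q)

/-- Transport along equalities of expressions. -/
def cast {ρ : Realization cs k V} {I J : FinSub cs} {p p' q q' : Expr I J}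
    (hp : p = p') (hq : q = q') (a : Diag ρ p q) : Diag ρ p' q' := hp ▸ hq ▸ a

/-- The left-facing crossing `[Is, I, It] → [Is, Ist, It]`, a rotation of the up-facing one. -/
def leftCross {I A C D : FinSub cs} {s t : B} (q : Square I A C D s t) :
    Diag ρ (dn q.ia ⬝ up q.ic) (up q.ad ⬝ dn q.cd) :=
  (id (dn q.ia ⬝ up q.ic) ⊠ cwCup q.cd)
    ⊚ (id (dn q.ia) ⊠ cross q ⊠ id (dn q.cd))
    ⊚ (ccwCap q.ia ⊠ id (up q.ad ⬝ dn q.cd))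

/-- The right-facing crossing `[Is, Ist, It] → [Is, I, It]`, a rotation of the up-facing one. -/
def rightCross {I A C D : FinSub cs} {s t : B} (q : Square I A C D s t) :
    Diag ρ (up q.ad ⬝ dn q.cd) (dn q.ia ⬝ up q.ic) :=
  (ccwCup q.ia ⊠ id (up q.ad ⬝ dn q.cd))
    ⊚ (id (dn q.ia) ⊠ cross q.symm ⊠ id (dn q.cd))
    ⊚ (id (dn q.ia ⬝ up q.ic) ⊠ cwCap q.cd)

/-- The down-facing crossing `[Ist, Is, I] → [Ist, It, I]`, obtained from the up-facing crossing
by a half turn with cups on the right and caps on the left. -/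
def downCross {I A C D : FinSub cs} {s t : B} (q : Square I A C D s t) :
    Diag ρ (dn q.ad ⬝ dn q.ia) (dn q.cd ⬝ dn q.ic) :=
  (id (dn q.ad ⬝ dn q.ia) ⊠ cwCup q.ic)
    ⊚ (id (dn q.ad ⬝ dn q.ia ⬝ up q.ic) ⊠ cwCup q.cd ⊠ id (dn q.ic))
    ⊚ (id (dn q.ad ⬝ dn q.ia) ⊠ cross q ⊠ id (dn q.cd ⬝ dn q.ic))
    ⊚ (id (dn q.ad) ⊠ ccwCap q.ia ⊠ id (up q.ad ⬝ dn q.cd ⬝ dn q.ic))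
    ⊚ (ccwCap q.ad ⊠ id (dn q.cd ⬝ dn q.ic))

/-- The same, by the opposite half turn, with cups on the left and caps on the right. -/
def downCross' {I A C D : FinSub cs} {s t : B} (q : Square I A C D s t) :
    Diag ρ (dn q.ad ⬝ dn q.ia) (dn q.cd ⬝ dn q.ic) :=
  (ccwCup q.cd ⊠ id (dn q.ad ⬝ dn q.ia))
    ⊚ (id (dn q.cd) ⊠ ccwCup q.ic ⊠ id (up q.cd ⬝ dn q.ad ⬝ dn q.ia))
    ⊚ (id (dn q.cd ⬝ dn q.ic) ⊠ cross q ⊠ id (dn q.ad ⬝ dn q.ia))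
    ⊚ (id (dn q.cd ⬝ dn q.ic ⬝ up q.ia) ⊠ cwCap q.ad ⊠ id (dn q.ia))
    ⊚ (id (dn q.cd ⬝ dn q.ic) ⊠ cwCap q.ia)

end Diag

open Diag

/-- The relations between 2-morphisms of `Frob`: the smallest congruence that makes the formal
diagrams a strict `k`-linear 2-category in which diagrams are considered up to isotopy, and
that contains the defining relations for polynomials, circles and Reidemeister moves. -/
inductive Rel :
    {I J : FinSub cs} → {p q : Expr I J} → Diag ρ p q → Diag ρ p q → Prop
  -- equivalence relation and congruence
  | refl {I J : FinSub cs} {p q : Expr I J} (a : Diag ρ p q) : Rel a a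
  | symm {I J : FinSub cs} {p q : Expr I J} {a b : Diag ρ p q} : Rel a b → Rel b a
  | trans {I J : FinSub cs} {p q : Expr I J} {a b c : Diag ρ p q} :
      Rel a b → Rel b c → Rel a c
  | vcomp_congr {I J : FinSub cs} {p q r : Expr I J} {a a' : Diag ρ p q} {b b' : Diag ρ q r} :
      Rel a a' → Rel b b' → Rel (a ⊚ b) (a' ⊚ b')
  | hcomp_congr {I J K : FinSub cs} {p q : Expr I J} {p' q' : Expr J K}
      {a a' : Diag ρ p q} {b b' : Diag ρ p' q'} :
      Rel a a' → Rel b b' → Rel (a ⊠ b) (a' ⊠ b')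
  | add_congr {I J : FinSub cs} {p q : Expr I J} {a a' b b' : Diag ρ p q} :
      Rel a a' → Rel b b' → Rel (a.add b) (a'.add b')
  | smul_congr {I J : FinSub cs} {p q : Expr I J} (x : k) {a a' : Diag ρ p q} :
      Rel a a' → Rel (a.smul x) (a'.smul x)
  -- vector space structure on 2-morphisms
  | add_comm {I J : FinSub cs} {p q : Expr I J} (a b : Diag ρ p q) : Rel (a.add b) (b.add a)
  | add_assoc {I J : FinSub cs} {p q : Expr I J} (a b c : Diag ρ p q) :
      Rel ((a.add b).add c) (a.add (b.add c))
  | zero_add {I J : FinSub cs} {p q : Expr I J} (a : Diag ρ p q) : Rel ((zero p q).add a) a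
  | neg_add {I J : FinSub cs} {p q : Expr I J} (a : Diag ρ p q) :
      Rel ((a.smul (-1)).add a) (zero p q)
  | smul_add {I J : FinSub cs} {p q : Expr I J} (x : k) (a b : Diag ρ p q) :
      Rel ((a.add b).smul x) ((a.smul x).add (b.smul x))
  | add_smul {I J : FinSub cs} {p q : Expr I J} (x y : k) (a : Diag ρ p q) :
      Rel (a.smul (x + y)) ((a.smul x).add (a.smul y))
  | mul_smul {I J : FinSub cs} {p q : Expr I J} (x y : k) (a : Diag ρ p q) :
      Rel (a.smul (x * y)) ((a.smul y).smul x)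
  | one_smul {I J : FinSub cs} {p q : Expr I J} (a : Diag ρ p q) : Rel (a.smul 1) a
  -- bilinearity of the two compositions
  | add_vcomp {I J : FinSub cs} {p q r : Expr I J} (a a' : Diag ρ p q) (b : Diag ρ q r) :
      Rel (a.add a' ⊚ b) ((a ⊚ b).add (a' ⊚ b))
  | vcomp_add {I J : FinSub cs} {p q r : Expr I J} (a : Diag ρ p q) (b b' : Diag ρ q r) :
      Rel (a ⊚ b.add b') ((a ⊚ b).add (a ⊚ b'))
  | smul_vcomp {I J : FinSub cs} {p q r : Expr I J} (x : k) (a : Diag ρ p q) (b : Diag ρ q r) :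
      Rel (a.smul x ⊚ b) ((a ⊚ b).smul x)
  | vcomp_smul {I J : FinSub cs} {p q r : Expr I J} (x : k) (a : Diag ρ p q) (b : Diag ρ q r) :
      Rel (a ⊚ b.smul x) ((a ⊚ b).smul x)
  | add_hcomp {I J K : FinSub cs} {p q : Expr I J} {p' q' : Expr J K}
      (a a' : Diag ρ p q) (b : Diag ρ p' q') : Rel (a.add a' ⊠ b) ((a ⊠ b).add (a' ⊠ b))
  | hcomp_add {I J K : FinSub cs} {p q : Expr I J} {p' q' : Expr J K}
      (a : Diag ρ p q) (b b' : Diag ρ p' q') : Rel (a ⊠ b.add b') ((a ⊠ b).add (a ⊠ b'))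
  | smul_hcomp {I J K : FinSub cs} {p q : Expr I J} {p' q' : Expr J K}
      (x : k) (a : Diag ρ p q) (b : Diag ρ p' q') : Rel (a.smul x ⊠ b) ((a ⊠ b).smul x)
  | hcomp_smul {I J K : FinSub cs} {p q : Expr I J} {p' q' : Expr J K}
      (x : k) (a : Diag ρ p q) (b : Diag ρ p' q') : Rel (a ⊠ b.smul x) ((a ⊠ b).smul x)
  -- strict 2-category
  | id_vcomp {I J : FinSub cs} {p q : Expr I J} (a : Diag ρ p q) : Rel (Diag.id p ⊚ a) a
  | vcomp_id {I J : FinSub cs} {p q : Expr I J} (a : Diag ρ p q) : Rel (a ⊚ Diag.id q) a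
  | vcomp_assoc {I J : FinSub cs} {p q r t : Expr I J} (a : Diag ρ p q) (b : Diag ρ q r)
      (c : Diag ρ r t) : Rel (a ⊚ b ⊚ c) (a ⊚ (b ⊚ c))
  | id_hcomp_id {I J K : FinSub cs} (p : Expr I J) (q : Expr J K) :
      Rel (Diag.id p ⊠ Diag.id q) (Diag.id (p ⬝ q))
  | interchange {I J K : FinSub cs} {p q r : Expr I J} {p' q' r' : Expr J K}
      (a : Diag ρ p q) (b : Diag ρ q r) (a' : Diag ρ p' q') (b' : Diag ρ q' r') :
      Rel ((a ⊚ b) ⊠ (a' ⊚ b')) ((a ⊠ a') ⊚ (b ⊠ b'))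
  | hcomp_assoc {I J K L : FinSub cs} {p p' : Expr I J} {q q' : Expr J K} {r r' : Expr K L}
      (a : Diag ρ p p') (b : Diag ρ q q') (c : Diag ρ r r') :
      Rel (Diag.cast (Quiver.Path.comp_assoc p q r) (Quiver.Path.comp_assoc p' q' r')
        (a ⊠ b ⊠ c)) (a ⊠ (b ⊠ c))
  | nil_hcomp {I J : FinSub cs} {p q : Expr I J} (a : Diag ρ p q) :
      Rel (Diag.cast (Quiver.Path.nil_comp p) (Quiver.Path.nil_comp q)
        (Diag.id (nil I) ⊠ a)) a
  | hcomp_nil {I J : FinSub cs} {p q : Expr I J} (a : Diag ρ p q) :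
      Rel (a ⊠ Diag.id (nil J)) a
  -- isotopy: the zigzag relations and the cyclicity of the crossing
  | zigzag_up {I J : FinSub cs} {s : B} (h : IsAdd I J s) :
      Rel ((cwCup h ⊠ Diag.id (up h)) ⊚ (Diag.id (up h) ⊠ ccwCap h)) (Diag.id (up h))
  | zigzag_up' {I J : FinSub cs} {s : B} (h : IsAdd I J s) :
      Rel ((Diag.id (up h) ⊠ ccwCup h) ⊚ (cwCap h ⊠ Diag.id (up h))) (Diag.id (up h))
  | zigzag_dn {I J : FinSub cs} {s : B} (h : IsAdd I J s) :
      Rel ((Diag.id (dn h) ⊠ cwCup h) ⊚ (ccwCap h ⊠ Diag.id (dn h))) (Diag.id (dn h))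
  | zigzag_dn' {I J : FinSub cs} {s : B} (h : IsAdd I J s) :
      Rel ((ccwCup h ⊠ Diag.id (dn h)) ⊚ (Diag.id (dn h) ⊠ cwCap h)) (Diag.id (dn h))
  | cyclic {I A C D : FinSub cs} {s t : B} (q : Square I A C D s t) :
      Rel (downCross ρ q) (downCross' ρ q)
  -- polynomials add and multiply as expected
  | poly_add {I : FinSub cs} (f g : ρ.inv I) : Rel (poly (f + g)) ((poly f).add (poly g))
  | poly_smul {I : FinSub cs} (x : k) (f : ρ.inv I) : Rel (poly (x • f)) ((poly f).smul x)
  | poly_one (I : FinSub cs) : Rel (poly (1 : ρ.inv I)) (Diag.id (nil I))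
  | poly_mul {I : FinSub cs} (f g : ρ.inv I) : Rel (poly (f * g)) (poly f ⊚ poly g)
  -- polynomial sliding
  | slide {I J : FinSub cs} {s : B} (h : IsAdd I J s) (f : ρ.inv J) :
      Rel (poly (incl ρ h f) ⊠ Diag.id (up h)) (Diag.id (up h) ⊠ poly f)
  -- circle evaluations
  | cwCircle {I J : FinSub cs} {s : B} (h : IsAdd I J s) {n : ℕ} (c d : Fin n → ρ.inv I)
      (hcd : ρ.IsDualBases I J c d) :
      Rel (cwCup h ⊚ cwCap h) (poly (∑ i, c i * d i))
  | ccwCircle {I J : FinSub cs} {s : B} (h : IsAdd I J s) (f : ρ.inv I) :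
      Rel (ccwCup h ⊚ (Diag.id (dn h) ⊠ poly f ⊠ Diag.id (up h)) ⊚ ccwCap h)
        (poly (ρ.trace I J f))
  -- idempotent decomposition
  | idemp {I J : FinSub cs} {s : B} (h : IsAdd I J s) {n : ℕ} (c d : Fin n → ρ.inv I)
      (hcd : ρ.IsDualBases I J c d) :
      Rel (Diag.id (dn h ⬝ up h)) (Diag.sum fun i =>
        (Diag.id (dn h) ⊠ poly (c i) ⊠ Diag.id (up h)) ⊚ ccwCap h
          ⊚ (ccwCup h ⊚ (Diag.id (dn h) ⊠ poly (d i) ⊠ Diag.id (up h))))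
  -- easy Reidemeister II
  | r2_easy {I A C D : FinSub cs} {s t : B} (q : Square I A C D s t) :
      Rel (cross q ⊚ cross q.symm) (Diag.id (up q.ic ⬝ up q.cd))
  -- hard Reidemeister II
  | r2_hard {I A C D : FinSub cs} {s t : B} (q : Square I A C D s t) (μ : ρ.inv I)
      (hμ : (μ : SymmetricAlgebra k V) =
        Realization.rootProd (ρ.posRoots D \ (ρ.posRoots A ∪ ρ.posRoots C))) :
      Rel (leftCross ρ q ⊚ rightCross ρ q) (Diag.id (dn q.ia) ⊠ poly μ ⊠ Diag.id (up q.ic))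
  | r2_hard' {I A C D : FinSub cs} {s t : B} (q : Square I A C D s t) (g : ρ.inv I) {n : ℕ}
      (c d : Fin n → ρ.inv C) (hcd : ρ.IsDualBases C D c d) :
      Rel (rightCross ρ q ⊚ (Diag.id (dn q.ia) ⊠ poly g ⊠ Diag.id (up q.ic)) ⊚ leftCross ρ q)
        (Diag.sum fun i =>
          poly (ρ.trace I A (g * incl ρ q.ic (c i))) ⊠ Diag.id (up q.ad ⬝ dn q.cd) ⊠ poly (d i))
  -- easy Reidemeister III
  | r3_easy {I A C E AC AE CE D : FinSub cs} {s t u : B} (q : Cube I A C E AC AE CE D s t u) :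
      Rel
        ((cross q.tu ⊠ Diag.id (up q.overC.cd)) ⊚ (Diag.id (up q.st.ic) ⊠ cross q.overC)
          ⊚ (cross q.st ⊠ Diag.id (up q.overA.ad)))
        ((Diag.id (up q.su.ic) ⊠ cross q.overE) ⊚ (cross q.su ⊠ Diag.id (up q.overE.ad))
          ⊚ (Diag.id (up q.st.ia) ⊠ cross q.overA))
  -- hard Reidemeister III
  | r3_hard {I A C E AC AE CE D : FinSub cs} {s t u : B} (q : Cube I A C E AC AE CE D s t u)
      (μ : ρ.inv I) (hμ : (μ : SymmetricAlgebra k V) =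
        Realization.rootProd (ρ.posRoots D \ (ρ.posRoots AC ∪ ρ.posRoots AE ∪ ρ.posRoots CE))) :
      Rel
        ((Diag.id (up q.st.ad) ⊠ leftCross ρ q.overC)
          ⊚ (cross q.overA.symm ⊠ Diag.id (dn q.overE.cd))
          ⊚ (Diag.id (up q.su.ad) ⊠ rightCross ρ q.overE))
        ((rightCross ρ q.st ⊠ Diag.id (up q.tu.ad))
          ⊚ (Diag.id (dn q.st.ia) ⊠ poly μ ⊠ Diag.id (up q.tu.ia ⬝ up q.tu.ad))
          ⊚ (Diag.id (dn q.st.ia) ⊠ cross q.tu.symm)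
          ⊚ (leftCross ρ q.su ⊠ Diag.id (up q.tu.cd)))

/-- Equality of diagrams in `Frob`. -/
def frobSetoid {I J : FinSub cs} (p q : Expr I J) :
    Setoid (Diag ρ p q) := ⟨Rel ρ, ⟨Rel.refl, Rel.symm, Rel.trans⟩⟩

/-- The space of 2-morphisms `p → q` in `Frob`. -/
def FrobHom {I J : FinSub cs} (p q : Expr I J) : Type (max uB uk uV) :=
  Quotient (frobSetoid ρ p q)

variable {ρ} in
/-- The 2-morphism of `Frob` represented by a formal diagram. -/
def FrobHom.mk {I J : FinSub cs} {p q : Expr I J} (a : Diag ρ p q) :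
    FrobHom ρ p q := Quotient.mk (frobSetoid ρ p q) a

/-! ## The nested circle diagram -/

/-- The finitary set `S \ {a}`. -/
def hat (S : FinSub cs) (a : B) : FinSub cs :=
  ⟨S.carrier \ {a}, S.finitary.subset (parabolic_mono cs Set.sdiff_subset)⟩

/-- The finitary set `S \ {a, b}`. -/
def hat₂ (S : FinSub cs) (a b : B) : FinSub cs :=
  ⟨S.carrier \ {a, b}, S.finitary.subset (parabolic_mono cs Set.sdiff_subset)⟩

theorem isAdd_hat {S : FinSub cs} {a : B} (ha : a ∈ S.carrier) : IsAdd (hat S a) S a where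
  notMem := fun h => h.2 rfl
  eq := by
    ext x
    simp only [hat, Set.mem_insert_iff, Set.mem_sdiff, Set.mem_singleton_iff]
    by_cases h : x = a
    · simp [h, ha]
    · simp [h]

theorem isAdd_hat₂_left {S : FinSub cs} {a b : B} (ha : a ∈ S.carrier) (hab : a ≠ b) :
    IsAdd (hat₂ S a b) (hat S b) a where
  notMem := fun h => h.2 (Or.inl rfl)
  eq := by
    ext x
    simp only [hat, hat₂, Set.mem_insert_iff, Set.mem_sdiff, Set.mem_singleton_iff]
    by_cases h : x = a
    · simp [h, ha, hab]
    · simp [h]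

theorem isAdd_hat₂_right {S : FinSub cs} {a b : B} (hb : b ∈ S.carrier) (hab : a ≠ b) :
    IsAdd (hat₂ S a b) (hat S a) b where
  notMem := fun h => h.2 (Or.inr rfl)
  eq := by
    ext x
    simp only [hat, hat₂, Set.mem_insert_iff, Set.mem_sdiff, Set.mem_singleton_iff]
    by_cases h : x = b
    · simp [h, hb, Ne.symm hab]
    · simp [h]

/-- The square `S \ {a, b} ⊂ S \ {a}, S \ {b} ⊂ S`. -/
theorem hatSquare {S : FinSub cs} {a b : B} (ha : a ∈ S.carrier) (hb : b ∈ S.carrier)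
    (hab : a ≠ b) : Square (hat₂ S a b) (hat S a) (hat S b) S b a :=
  ⟨isAdd_hat₂_right hb hab, isAdd_hat₂_left ha hab, isAdd_hat ha, isAdd_hat hb⟩

/-- `u 0, …, u d` lie in `S` and consecutive entries are distinct. -/
structure IsSeq (S : FinSub cs) (u : ℕ → B) (d : ℕ) : Prop where
  mem : ∀ i ≤ d, u i ∈ S.carrier
  ne : ∀ i < d, u i ≠ u (i + 1)

namespace IsSeq

variable {S : FinSub cs} {u : ℕ → B}

theorem prev {d : ℕ} (h : IsSeq S u (d + 1)) : IsSeq S u d :=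
  ⟨fun i hi => h.mem i (by omega), fun i hi => h.ne i (by omega)⟩

/-- The square formed by the last two entries of the sequence. -/
theorem square {n : ℕ} (h : IsSeq S u (n + 1)) :
    Square (hat₂ S (u n) (u (n + 1))) (hat S (u n)) (hat S (u (n + 1))) S (u (n + 1)) (u n) :=
  hatSquare (h.mem n (by omega)) (h.mem (n + 1) (by omega)) (h.ne n (by omega))

theorem add {n : ℕ} (h : IsSeq S u n) : IsAdd (hat S (u n)) S (u n) :=
  isAdd_hat (h.mem n le_rfl)

theorem addZero {n : ℕ} (h : IsSeq S u n) : IsAdd (hat S (u 0)) S (u 0) :=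
  isAdd_hat (h.mem 0 (Nat.zero_le _))

/-- `K = [I + u_0 - u_d]`, where `I = S \ {u_0}` and `d = n + 1`. -/
def K {n : ℕ} (h : IsSeq S u (n + 1)) : Expr (hat S (u 0)) (hat S (u (n + 1))) :=
  up h.addZero ⬝ dn h.add

/-- `L' = [I - u_1 + u_0 - u_2 + u_1 ⋯ - u_d]`, where `d = n + 1`. -/
def L' : {n : ℕ} → (h : IsSeq S u (n + 1)) → Expr (hat S (u 0)) (hat₂ S (u n) (u (n + 1)))
  | 0, h => dn h.square.ia
  | _ + 1, h => L' h.prev ⬝ up h.prev.square.ic ⬝ dn h.square.ia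

/-- `L = L' + u_{d-1} = [I - u_1 + u_0 - u_2 + u_1 ⋯ - u_d + u_{d-1}]`, where `d = n + 1`. -/
def L {n : ℕ} (h : IsSeq S u (n + 1)) : Expr (hat S (u 0)) (hat S (u (n + 1))) :=
  L' h ⬝ up h.square.ic

/-- The bottom half of the diagram. The strands `u_0` and `u_d` are vertical; for each of
`u_1, …, u_{d-1}` there is a counterclockwise cup, and the strands `+u_i` and `-u_{i+1}` cross for
every `i < d`. -/
def bottom : {n : ℕ} → (h : IsSeq S u (n + 1)) → Diag ρ h.K h.L
  | 0, h => rightCross ρ h.square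
  | _ + 1, h =>
      (Diag.id (up h.addZero) ⊠ ccwCup h.prev.add ⊠ Diag.id (dn h.add))
        ⊚ (bottom h.prev ⊠ rightCross ρ h.square)

/-- The top half of the diagram, the bottom half turned upside down. -/
def top : {n : ℕ} → (h : IsSeq S u (n + 1)) → Diag ρ h.L h.K
  | 0, h => leftCross ρ h.square
  | _ + 1, h =>
      (top h.prev ⊠ leftCross ρ h.square)
        ⊚ (Diag.id (up h.addZero) ⊠ ccwCap h.prev.add ⊠ Diag.id (dn h.add))

/-- The nested circle diagram `K → L → K` with the polynomial `g ∈ R^M` in the region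
`M = S \ {u_{d-1}, u_d}`, where `d = n + 1`. -/
def circles {n : ℕ} (h : IsSeq S u (n + 1))
    (g : ρ.inv (hat₂ S (u n) (u (n + 1)))) : Diag ρ h.K h.K :=
  bottom ρ h ⊚ (Diag.id h.L' ⊠ poly g ⊠ Diag.id (up h.square.ic)) ⊚ top ρ h

/-- The identity of `K` with `f ∈ R^{S \ u_0}` on its left and `f' ∈ R^{S \ u_d}` on its right,
where `d = n + 1`. -/
def idWithPolys {n : ℕ} (h : IsSeq S u (n + 1))
    (f : ρ.inv (hat S (u 0))) (f' : ρ.inv (hat S (u (n + 1)))) : Diag ρ h.K h.K :=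
  poly f ⊠ Diag.id h.K ⊠ poly f'

end IsSeq

end Expressions

end

end SoergelCalculus

open SoergelCalculus

/-! The diagram for `d` is built from the one for `d - 1`. The cup and cap coloured `u_{d-1}`
enclose two columns: on the left the previous diagram, with no polynomial in it, and on the right a
bigon formed by the strands `+u_{d-1}` and `-u_d`, with `g` between them (`mk_circles_succ`).

The hard Reidemeister II relation resolves this bigon (`bigon_eq_sum`). It produces the coproduct:
`d i` appears at the far right, and the trace of `g * c i` appears to the left of the strand
`+u_{d-1}`. The circle `u_{d-1}` no longer meets `-u_d`, so the trace can slide over `+u_{d-2}` into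
the innermost region of the previous diagram (`conj_cup_hcomp_poly`). What remains is the previous
diagram with its last strand closed up on the right.

This closure is evaluated without any further dual bases: closing the last strand of the diagram
containing `f` gives `∂_{L'}(f)` to the left of `+u_0` (`close_mk_circles`). The proof is an
induction on the number of circles. Closing affects only the last bigon, which becomes a circle
`u_d` overlapping the strand `+u_{d-1}`. Easy Reidemeister II pulls the circle off to the left,
where it evaluates to a trace (`close_bigon`). Sliding this trace as above reduces to the shorter
diagram. Each round contributes one trace and one inclusion, which are the last two steps of `L'`.

Regrouping expressions such as `(p ⬝ q) ⬝ r` is in general only a propositional equality. The laws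
below therefore take the boundary equations of `hcomp` as arguments, so that a change of bracketing
becomes a change of proof and no transports appear in calculations. -/

namespace SoergelCalculus

universe uB uW uk uV

/-! ### The compositions on the 2-morphism spaces of `Frob` -/

namespace FrobHom

variable {B : Type uB} {W : Type uW} [Group W] {M : CoxeterMatrix B} {cs : CoxeterSystem M W}
  {k : Type uk} {V : Type uV} [Field k] [AddCommGroup V] [Module k V] {ρ : Realization cs k V}
  {I J K L : FinSub cs}

/-- The identity 2-morphism. -/
def id (p : Expr I J) : FrobHom ρ p p := mk (Diag.id p)

/-- A polynomial in a region. -/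
def poly (f : ρ.inv I) : FrobHom ρ (nil I) (nil I) := mk (Diag.poly f)

/-- Vertical composition, the first argument at the bottom. -/
def vcomp {p q r : Expr I J} : FrobHom ρ p q → FrobHom ρ q r → FrobHom ρ p r :=
  Quotient.map₂ Diag.vcomp fun _ _ h _ _ h' => Rel.vcomp_congr h h'

/-- Transport along equalities of expressions. -/
def cast {p p' q q' : Expr I J} (hp : p = p') (hq : q = q') (a : FrobHom ρ p q) :
    FrobHom ρ p' q' := hp ▸ hq ▸ a

/-- Horizontal composition, the first argument on the left; source and target are
given up to equality of expressions. -/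
def hcomp {p q : Expr I J} {p' q' : Expr J K} {P Q : Expr I K} (a : FrobHom ρ p q)
    (b : FrobHom ρ p' q') (hP : P = p.comp p') (hQ : Q = q.comp q') :
    FrobHom ρ P Q :=
  cast hP.symm hQ.symm
    (Quotient.map₂ Diag.hcomp (fun _ _ h _ _ h' => Rel.hcomp_congr h h') a b)

local infixl:68 " ⊚ " => vcomp
local infixl:75 " ⬝ " => Quiver.Path.comp

/-! ### Additive structure and finite sums -/

section Additive

variable {p q : Expr I J}

instance : Add (FrobHom ρ p q) :=
  ⟨Quotient.map₂ Diag.add fun _ _ h _ _ h' => Rel.add_congr h h'⟩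

instance : Zero (FrobHom ρ p q) := ⟨mk (Diag.zero p q)⟩

instance : Neg (FrobHom ρ p q) :=
  ⟨Quotient.map (Diag.smul (-1)) fun _ _ h => Rel.smul_congr (-1) h⟩

protected theorem add_comm (a b : FrobHom ρ p q) : a + b = b + a := by
  induction a using Quotient.ind; induction b using Quotient.ind
  exact Quotient.sound (Rel.add_comm _ _)

protected theorem zero_add (a : FrobHom ρ p q) : 0 + a = a := by
  induction a using Quotient.ind
  exact Quotient.sound (Rel.zero_add _)

instance : AddCommGroup (FrobHom ρ p q) where
  add_assoc a b c := by
    induction a using Quotient.ind; induction b using Quotient.ind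
    induction c using Quotient.ind
    exact Quotient.sound (Rel.add_assoc _ _ _)
  zero_add := FrobHom.zero_add
  add_zero a := by rw [FrobHom.add_comm, FrobHom.zero_add]
  add_comm := FrobHom.add_comm
  neg_add_cancel a := by
    induction a using Quotient.ind
    exact Quotient.sound (Rel.neg_add _)
  nsmul := nsmulRec
  zsmul := zsmulRec

theorem mk_sum {n : ℕ} (f : Fin n → Diag ρ p q) : mk (Diag.sum f) = ∑ i, mk (f i) := by
  -- Both sides become right folds over the list `List.finRange n`, which list induction compares.
  rw [← List.sum_ofFn, Diag.sum, List.ofFn_eq_map, List.ofFn_eq_map]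
  induction List.finRange n with
  | nil => rfl
  | cons i l ih =>
    rw [List.map_cons, List.map_cons, List.sum_cons, ← ih]
    rfl

end Additive

/-! ### Additivity of the two compositions -/

theorem add_vcomp {p q r : Expr I J} (a a' : FrobHom ρ p q) (b : FrobHom ρ q r) :
    (a + a') ⊚ b = a ⊚ b + a' ⊚ b := by
  induction a using Quotient.ind; induction a' using Quotient.ind
  induction b using Quotient.ind
  exact Quotient.sound (Rel.add_vcomp _ _ _)

theorem vcomp_add {p q r : Expr I J} (a : FrobHom ρ p q) (b b' : FrobHom ρ q r) :
    a ⊚ (b + b') = a ⊚ b + a ⊚ b' := by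
  induction a using Quotient.ind; induction b using Quotient.ind
  induction b' using Quotient.ind
  exact Quotient.sound (Rel.vcomp_add _ _ _)

theorem hcomp_add {p q : Expr I J} {p' q' : Expr J K} {P Q : Expr I K} (a : FrobHom ρ p q)
    (b b' : FrobHom ρ p' q') (hP : P = p.comp p') (hQ : Q = q.comp q') :
    hcomp a (b + b') hP hQ = hcomp a b hP hQ + hcomp a b' hP hQ := by
  subst hP hQ
  induction a using Quotient.ind; induction b using Quotient.ind
  induction b' using Quotient.ind
  exact Quotient.sound (Rel.hcomp_add _ _ _)

theorem sum_vcomp {p q r : Expr I J} {n : ℕ} (a : Fin n → FrobHom ρ p q) (b : FrobHom ρ q r) :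
    (∑ i, a i) ⊚ b = ∑ i, (a i ⊚ b) :=
  map_sum (AddMonoidHom.mk' (· ⊚ b) fun x y => add_vcomp x y b) a Finset.univ

theorem vcomp_sum {p q r : Expr I J} {n : ℕ} (a : FrobHom ρ p q) (b : Fin n → FrobHom ρ q r) :
    a ⊚ (∑ i, b i) = ∑ i, (a ⊚ b i) :=
  map_sum (AddMonoidHom.mk' (a ⊚ ·) (vcomp_add a)) b Finset.univ

theorem hcomp_sum {p q : Expr I J} {p' q' : Expr J K} {P Q : Expr I K} {n : ℕ}
    (a : FrobHom ρ p q) (b : Fin n → FrobHom ρ p' q') (hP : P = p.comp p')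
    (hQ : Q = q.comp q') : hcomp a (∑ i, b i) hP hQ = ∑ i, hcomp a (b i) hP hQ :=
  map_sum (AddMonoidHom.mk' (hcomp a · hP hQ) fun x y => hcomp_add a x y hP hQ) b Finset.univ

/-! ### Laws of a strict 2-category -/

@[simp] theorem id_vcomp {p q : Expr I J} (a : FrobHom ρ p q) : id p ⊚ a = a := by
  induction a using Quotient.ind
  exact Quotient.sound (Rel.id_vcomp _)

@[simp] theorem vcomp_id {p q : Expr I J} (a : FrobHom ρ p q) : a ⊚ id q = a := by
  induction a using Quotient.ind
  exact Quotient.sound (Rel.vcomp_id _)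

theorem vcomp_assoc {p q r t : Expr I J} (a : FrobHom ρ p q) (b : FrobHom ρ q r)
    (c : FrobHom ρ r t) : a ⊚ b ⊚ c = a ⊚ (b ⊚ c) := by
  induction a using Quotient.ind; induction b using Quotient.ind
  induction c using Quotient.ind
  exact Quotient.sound (Rel.vcomp_assoc _ _ _)

theorem id_hcomp_id {p : Expr I J} {q : Expr J K} {P : Expr I K} (hP hQ : P = p.comp q) :
    hcomp (id p : FrobHom ρ p p) (id q) hP hQ = id P := by
  subst hP
  exact Quotient.sound (Rel.id_hcomp_id _ _)

theorem interchange {p q r : Expr I J} {p' q' r' : Expr J K} {P Q R : Expr I K}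
    (a : FrobHom ρ p q) (b : FrobHom ρ q r) (a' : FrobHom ρ p' q') (b' : FrobHom ρ q' r')
    (hP : P = p.comp p') (hQ hQ' : Q = q.comp q') (hR : R = r.comp r') :
    hcomp a a' hP hQ ⊚ hcomp b b' hQ' hR = hcomp (a ⊚ b) (a' ⊚ b') hP hR := by
  subst hP hQ hR
  induction a using Quotient.ind; induction b using Quotient.ind
  induction a' using Quotient.ind; induction b' using Quotient.ind
  exact Quotient.sound (Rel.symm (Rel.interchange _ _ _ _))

theorem hcomp_nil {p q : Expr I J} (a : FrobHom ρ p q) (hP : p = p.comp (nil J))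
    (hQ : q = q.comp (nil J)) : hcomp a (id (nil J)) hP hQ = a := by
  induction a using Quotient.ind
  exact Quotient.sound (Rel.hcomp_nil _)

theorem mk_cast {p p' q q' : Expr I J} (hp : p = p') (hq : q = q') (a : Diag ρ p q) :
    mk (Diag.cast hp hq a) = cast hp hq (mk a) := by
  subst hp hq; rfl

theorem cast_hcomp {p q : Expr I J} {p' q' : Expr J K} {P Q P' Q' : Expr I K}
    (a : FrobHom ρ p q) (b : FrobHom ρ p' q') (h : P = P') (h' : Q = Q')
    (hP : P = p.comp p') (hQ : Q = q.comp q') :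
    cast h h' (hcomp a b hP hQ) = hcomp a b (h ▸ hP) (h' ▸ hQ) := by
  subst h h'; rfl

/-- All eight boundary equations are free arguments, so rewriting in either direction can choose the
names under which the regrouped boundaries appear. -/
theorem hcomp_assoc {p p' : Expr I J} {q q' : Expr J K} {r r' : Expr K L}
    {pq pq' : Expr I K} {qr qr' : Expr J L} {P P' : Expr I L}
    (a : FrobHom ρ p p') (b : FrobHom ρ q q') (c : FrobHom ρ r r')
    (h₁ : pq = p.comp q) (h₂ : pq' = p'.comp q') (h₃ : P = pq.comp r) (h₄ : P' = pq'.comp r')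
    (h₅ : qr = q.comp r) (h₆ : qr' = q'.comp r') (h₇ : P = p.comp qr) (h₈ : P' = p'.comp qr') :
    hcomp (hcomp a b h₁ h₂) c h₃ h₄ = hcomp a (hcomp b c h₅ h₆) h₇ h₈ := by
  subst h₁ h₂ h₅ h₆ h₇ h₈
  have h : cast (Quiver.Path.comp_assoc p q r) (Quiver.Path.comp_assoc p' q' r')
      (hcomp (hcomp a b rfl rfl) c rfl rfl) = hcomp a (hcomp b c rfl rfl) rfl rfl := by
    induction a using Quotient.ind; induction b using Quotient.ind
    induction c using Quotient.ind
    exact (mk_cast _ _ _).symm.trans (Quotient.sound (Rel.hcomp_assoc _ _ _))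
  rw [← h, cast_hcomp]

theorem slide {s : B} (h : IsAdd I J s) (f : ρ.inv J) (h₁ h₂ : up h = (nil I).comp (up h))
    (h₃ h₄ : up h = (up h).comp (nil J)) :
    hcomp (poly (incl ρ h f)) (id (up h)) h₁ h₂ = hcomp (id (up h)) (poly f) h₃ h₄ :=
  Quotient.sound (Rel.slide h f)

theorem vcomp_hcomp_id {p q r : Expr I J} {z : Expr J K} {P Q R : Expr I K}
    (a : FrobHom ρ p q) (b : FrobHom ρ q r) (hP : P = p.comp z) (hQ : Q = q.comp z)
    (hR : R = r.comp z) : hcomp (a ⊚ b) (id z) hP hR =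
      hcomp a (id z) hP hQ ⊚ hcomp b (id z) hQ hR := by
  rw [interchange, vcomp_id]

/-- Diagrams that lie next to each other can be moved past each other. -/
theorem exchange {p q : Expr I J} {p' q' : Expr J K} {P Q R S : Expr I K}
    (a : FrobHom ρ p q) (b : FrobHom ρ p' q') (hP : P = p.comp p') (hQ : Q = q.comp p')
    (hR : R = p.comp q') (hS : S = q.comp q') :
    hcomp a (id p') hP hQ ⊚ hcomp (id q) b hQ hS =
      hcomp (id p) b hP hR ⊚ hcomp a (id q') hR hS := by
  simp only [interchange, id_vcomp, vcomp_id]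

/-! ### Generators and zigzag relations -/

/-- The counterclockwise cup. -/
def cup {s : B} (h : IsAdd I J s) : FrobHom ρ (nil J) (dn h ⬝ up h) := mk (Diag.ccwCup h)

/-- The counterclockwise cap. -/
def cap {s : B} (h : IsAdd I J s) : FrobHom ρ (dn h ⬝ up h) (nil J) := mk (Diag.ccwCap h)

/-- The clockwise cup. -/
def cup' {s : B} (h : IsAdd I J s) : FrobHom ρ (nil I) (up h ⬝ dn h) := mk (Diag.cwCup h)

/-- The clockwise cap. -/
def cap' {s : B} (h : IsAdd I J s) : FrobHom ρ (up h ⬝ dn h) (nil I) := mk (Diag.cwCap h)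

/-- The up-facing crossing. -/
def cross {I A C D : FinSub cs} {s t : B} (q : Square I A C D s t) :
    FrobHom ρ (up q.ic ⬝ up q.cd) (up q.ia ⬝ up q.ad) := mk (Diag.cross q)

theorem zigzag_up {s : B} (h : IsAdd I J s) {m : Expr I J} (h₁ : up h = nil I ⬝ up h)
    (h₂ : m = up h ⬝ dn h ⬝ up h) (h₃ : m = up h ⬝ (dn h ⬝ up h)) (h₄ : up h = up h ⬝ nil J) :
    hcomp (cup' h) (id (up h)) h₁ h₂ ⊚ hcomp (id (up h)) (cap h) h₃ h₄ =
      (id (up h) : FrobHom ρ _ _) := by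
  subst h₂
  exact Quotient.sound (Rel.zigzag_up h)

theorem zigzag_up' {s : B} (h : IsAdd I J s) {m : Expr I J} (h₁ : up h = up h ⬝ nil J)
    (h₂ : m = up h ⬝ (dn h ⬝ up h)) (h₃ : m = up h ⬝ dn h ⬝ up h) (h₄ : up h = nil I ⬝ up h) :
    hcomp (id (up h)) (cup h) h₁ h₂ ⊚ hcomp (cap' h) (id (up h)) h₃ h₄ =
      (id (up h) : FrobHom ρ _ _) := by
  subst h₂
  exact Quotient.sound (Rel.zigzag_up' h)

/-! ### Bending a strand at the right boundary -/

section Adjuncts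

variable {s : B} (h : IsAdd I J s) {x R : Expr K J} {r P : Expr K I}

/-- The adjunct `x ⬝ [-s] → r` of a 2-morphism `x → r ⬝ [+s]`. -/
def turnCap (a : FrobHom ρ x R) (hP : P = x ⬝ dn h) (hR : R = r ⬝ up h) : FrobHom ρ P r :=
  hcomp a (id (dn h)) hP rfl ⊚
    hcomp (id r) (cap' h) (by rw [hR, Quiver.Path.comp_assoc]) (Quiver.Path.comp_nil r).symm

/-- The adjunct `r → x ⬝ [-s]` of a 2-morphism `r ⬝ [+s] → x`. -/
def turnCup (a : FrobHom ρ R x) (hP : P = x ⬝ dn h) (hR : R = r ⬝ up h) : FrobHom ρ r P :=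
  hcomp (id r) (cup' h) (Quiver.Path.comp_nil r).symm (by rw [hR, Quiver.Path.comp_assoc]) ⊚
    hcomp a (id (dn h)) rfl hP

/-- The cup lies to the right of `a`, so it can be moved above `a`. There it forms a zigzag with the
clockwise cap of `turnCap`, and the zigzag straightens. -/
theorem cup_turnCap (a : FrobHom ρ x R) (hP : P = x ⬝ dn h) (hR : R = r ⬝ up h)
    {Q : Expr K J} (h₁ : x = x ⬝ nil J) (h₂ : Q = x ⬝ (dn h ⬝ up h)) (h₃ : Q = P ⬝ up h) :
    hcomp (id x) (cup h) h₁ h₂ ⊚ hcomp (turnCap h a hP hR) (id (up h)) h₃ hR = a := by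
  have z₁ : up h = nil I ⬝ up h := (Quiver.Path.nil_comp _).symm
  have z₂ : R ⬝ dn h ⬝ up h = r ⬝ (up h ⬝ dn h ⬝ up h) := by
    simp only [hR, Quiver.Path.comp_assoc]
  have z₃ : up h ⬝ dn h ⬝ up h = up h ⬝ (dn h ⬝ up h) := Quiver.Path.comp_assoc _ _ _
  have z₄ : R ⬝ dn h ⬝ up h = R ⬝ (dn h ⬝ up h) := Quiver.Path.comp_assoc _ _ _
  have z₅ : R = R ⬝ nil J := (Quiver.Path.comp_nil _).symm
  have z₆ : up h = up h ⬝ nil J := (Quiver.Path.comp_nil _).symm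
  rw [turnCap, vcomp_hcomp_id (hQ := rfl),
    hcomp_assoc (h₅ := rfl) (h₆ := rfl) (h₇ := h₂) (h₈ := z₄),
    hcomp_assoc (h₅ := rfl) (h₆ := z₁) (h₇ := z₂) (h₈ := hR),
    id_hcomp_id rfl rfl, ← vcomp_assoc, ← exchange (hP := h₁) (hQ := z₅), hcomp_nil,
    vcomp_assoc, ← id_hcomp_id hR hR,
    hcomp_assoc (h₅ := z₆) (h₆ := z₃) (h₇ := hR) (h₈ := z₂), interchange, id_vcomp,
    zigzag_up', id_hcomp_id, vcomp_id]

/-- The upside-down version of `cup_turnCap`: here the cap moves below `a` and meets the clockwise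
cup. -/
theorem turnCup_cap (a : FrobHom ρ R x) (hP : P = x ⬝ dn h) (hR : R = r ⬝ up h)
    {Q : Expr K J} (h₁ : x = x ⬝ nil J) (h₂ : Q = x ⬝ (dn h ⬝ up h)) (h₃ : Q = P ⬝ up h) :
    hcomp (turnCup h a hP hR) (id (up h)) hR h₃ ⊚ hcomp (id x) (cap h) h₂ h₁ = a := by
  have z₁ : up h = nil I ⬝ up h := (Quiver.Path.nil_comp _).symm
  have z₂ : R ⬝ dn h ⬝ up h = r ⬝ (up h ⬝ dn h ⬝ up h) := by
    simp only [hR, Quiver.Path.comp_assoc]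
  have z₃ : up h ⬝ dn h ⬝ up h = up h ⬝ (dn h ⬝ up h) := Quiver.Path.comp_assoc _ _ _
  have z₄ : R ⬝ dn h ⬝ up h = R ⬝ (dn h ⬝ up h) := Quiver.Path.comp_assoc _ _ _
  have z₅ : R = R ⬝ nil J := (Quiver.Path.comp_nil _).symm
  have z₆ : up h = up h ⬝ nil J := (Quiver.Path.comp_nil _).symm
  rw [turnCup, vcomp_hcomp_id (hQ := rfl),
    hcomp_assoc (h₅ := z₁) (h₆ := rfl) (h₇ := hR) (h₈ := z₂),
    hcomp_assoc (h₅ := rfl) (h₆ := rfl) (h₇ := z₄) (h₈ := h₂),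
    id_hcomp_id rfl rfl, vcomp_assoc, exchange (hR := z₅) (hS := h₁), hcomp_nil,
    ← vcomp_assoc, ← id_hcomp_id hR hR,
    hcomp_assoc (h₅ := z₃) (h₆ := z₆) (h₇ := z₂) (h₈ := hR), interchange, id_vcomp,
    zigzag_up, id_hcomp_id, id_vcomp]

end Adjuncts

/-! ### Partial closure of the last strand -/

section Closure

variable {s : B} (h : IsAdd I J s)

/-- The partial closure on the right of an endomorphism of `x ⬝ [-s]`. -/
def close {x : Expr K J} {P : Expr K I} (hP : P = x ⬝ dn h) (a : FrobHom ρ P P) :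
    FrobHom ρ x x :=
  hcomp (id x) (cup h) (Quiver.Path.comp_nil x).symm rfl ⊚
    hcomp a (id (up h)) (by rw [hP, Quiver.Path.comp_assoc])
      (by rw [hP, Quiver.Path.comp_assoc]) ⊚
    hcomp (id x) (cap h) rfl (Quiver.Path.comp_nil x).symm

/-- Closing the strand undoes both bends: the closing cup straightens the lower one and the closing
cap the upper one, leaving an upward strand to the right of `w`. -/
theorem close_turn {x R : Expr K J} {r P : Expr K I} (a : FrobHom ρ x R) (w : FrobHom ρ r r)
    (b : FrobHom ρ R x) (hP : P = x ⬝ dn h) (hR : R = r ⬝ up h) :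
    close h hP (turnCap h a hP hR ⊚ w ⊚ turnCup h b hP hR) =
      a ⊚ hcomp w (id (up h)) hR hR ⊚ b := by
  rw [close, vcomp_hcomp_id (hQ := hR), vcomp_hcomp_id (hQ := hR), ← vcomp_assoc, ← vcomp_assoc,
    cup_turnCap, vcomp_assoc, turnCup_cap]

/-- Naturality of the partial trace: `a` and `b` do not touch the closed strand, so they move past
the closing cup and cap. -/
theorem close_conj {x y : Expr K J} {P Q : Expr K I} (hP : P = x ⬝ dn h) (hQ : Q = y ⬝ dn h)
    (a : FrobHom ρ x y) (w : FrobHom ρ Q Q) (b : FrobHom ρ y x) :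
    close h hP (hcomp a (id (dn h)) hP hQ ⊚ w ⊚ hcomp b (id (dn h)) hQ hP) =
      a ⊚ close h hQ w ⊚ b := by
  have z₁ : x = x ⬝ nil J := (Quiver.Path.comp_nil _).symm
  have z₂ : y = y ⬝ nil J := (Quiver.Path.comp_nil _).symm
  have z₃ : x ⬝ (dn h ⬝ up h) = P ⬝ up h := by rw [hP, Quiver.Path.comp_assoc]
  have z₄ : y ⬝ (dn h ⬝ up h) = Q ⬝ up h := by rw [hQ, Quiver.Path.comp_assoc]
  rw [close, vcomp_hcomp_id (hQ := z₄), vcomp_hcomp_id (hQ := z₄),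
    hcomp_assoc (h₅ := rfl) (h₆ := rfl) (h₇ := rfl) (h₈ := rfl),
    hcomp_assoc (h₅ := rfl) (h₆ := rfl) (h₇ := rfl) (h₈ := rfl), id_hcomp_id rfl rfl,
    ← vcomp_assoc, ← vcomp_assoc, ← exchange (hP := z₁) (hQ := z₂), hcomp_nil,
    vcomp_assoc _ _ (hcomp (id x) (cap h) _ _), exchange (hR := z₂) (hS := z₁), hcomp_nil,
    close]
  simp only [vcomp_assoc]

/-- The closing cup and cap lie entirely to the right of `p`, so closing a juxtaposition affects
only its right factor. -/
theorem close_hcomp {p : Expr L K} {x : Expr K J} {P : Expr K I} {X : Expr L J} {Y : Expr L I}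
    (hP : P = x ⬝ dn h) (hX : X = p ⬝ x) (hY : Y = X ⬝ dn h) (hY' : Y = p ⬝ P)
    (a : FrobHom ρ p p) (w : FrobHom ρ P P) :
    close h hY (hcomp a w hY' hY') = hcomp a (close h hP w) hX hX := by
  have z₁ : x = x ⬝ nil J := (Quiver.Path.comp_nil _).symm
  have z₂ : X ⬝ (dn h ⬝ up h) = p ⬝ (x ⬝ (dn h ⬝ up h)) := by rw [hX, Quiver.Path.comp_assoc]
  have z₃ : x ⬝ (dn h ⬝ up h) = P ⬝ up h := by rw [hP, Quiver.Path.comp_assoc]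
  rw [close, hcomp_assoc (h₅ := z₃) (h₆ := z₃) (h₇ := z₂) (h₈ := z₂), ← id_hcomp_id hX hX,
    hcomp_assoc (h₅ := z₁) (h₆ := rfl) (h₇ := hX) (h₈ := z₂),
    hcomp_assoc (h₅ := rfl) (h₆ := z₁) (h₇ := z₂) (h₈ := hX), interchange, interchange,
    id_vcomp, vcomp_id, close]

/-- If `b ⊚ t` is joined to an upward strand by a cup and a cap, a polynomial to the left of that
strand slides into the region between `b` and `t`. -/
theorem conj_cup_hcomp_poly {X : FinSub cs} {t : B} (m : IsAdd X I t) {x : Expr K J}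
    {P R : Expr K I} {r : Expr K X} {z : Expr J L} {A C : Expr K L} {D : Expr I L} {E : Expr K J}
    (hP : P = x ⬝ dn h) (hR : R = r ⬝ up m) (b : FrobHom ρ P R) (t : FrobHom ρ R P)
    (f : ρ.inv I) (w : FrobHom ρ z z) (h₀ : r = r ⬝ nil X) (h₁ : x = x ⬝ nil J)
    (h₂ : E = x ⬝ (dn h ⬝ up h)) (h₃ : A = x ⬝ z) (h₄ : C = E ⬝ z) (h₅ : up h = nil I ⬝ up h)
    (h₆ : D = up h ⬝ z) (h₇ : C = P ⬝ D) :
    hcomp (hcomp (id x) (cup h) h₁ h₂) (id z) h₃ h₄ ⊚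
        hcomp (b ⊚ t) (hcomp (hcomp (poly f) (id (up h)) h₅ h₅) w h₆ h₆) h₇ h₇ ⊚
        hcomp (hcomp (id x) (cap h) h₂ h₁) (id z) h₄ h₃ =
      hcomp (close h hP
        (b ⊚ hcomp (hcomp (id r) (poly (incl ρ m f)) h₀ h₀) (id (up m)) hR hR ⊚ t)) w h₃ h₃ := by
  have z₁ : up m = nil X ⬝ up m := (Quiver.Path.nil_comp _).symm
  have z₂ : up m = up m ⬝ nil I := (Quiver.Path.comp_nil _).symm
  have z₃ : R = R ⬝ nil I := (Quiver.Path.comp_nil _).symm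
  have z₄ : P = P ⬝ nil I := (Quiver.Path.comp_nil _).symm
  have z₅ : E = P ⬝ up h := by rw [h₂, hP, Quiver.Path.comp_assoc]
  rw [hcomp_assoc (a := id r) (h₅ := z₁) (h₆ := z₁) (h₇ := hR) (h₈ := hR), slide m f z₁ z₁ z₂ z₂,
    ← hcomp_assoc (h₁ := hR) (h₂ := hR) (h₃ := z₃) (h₄ := z₃), id_hcomp_id hR hR]
  -- Once slid over the last strand of `R`, the polynomial lies to the right of both `b` and `t`, so
  -- it can be placed beside `b ⊚ t`.
  have e : b ⊚ hcomp (id R) (poly f) z₃ z₃ ⊚ t = hcomp (b ⊚ t) (poly f) z₄ z₄ := by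
    conv_lhs => rw [← hcomp_nil b z₄ z₃, ← hcomp_nil t z₃ z₄]
    rw [interchange, interchange, vcomp_id, id_vcomp, vcomp_id]
  subst h₂
  rw [e, close, hcomp_assoc (b := poly f) (h₅ := h₅) (h₆ := h₅) (h₇ := z₅) (h₈ := z₅),
    ← hcomp_assoc (h₁ := z₅) (h₂ := z₅) (h₃ := h₄) (h₄ := h₄), interchange, interchange, id_vcomp,
    vcomp_id]

end Closure

/-! ### Crossings, bigons and overlapping circles -/

section Crossings

variable {I A C D : FinSub cs} {s t : B} (q : Square I A C D s t)

/-- An upward strand to the left of which a counterclockwise cup is created, crossing it. -/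
def crossCup : FrobHom ρ (up q.ad) (dn q.ia ⬝ up q.ic ⬝ up q.cd) :=
  hcomp (cup q.ia) (id (up q.ad)) (Quiver.Path.nil_comp _).symm
    (Quiver.Path.comp_assoc _ _ _).symm ⊚
    hcomp (id (dn q.ia)) (cross q.symm) rfl (Quiver.Path.comp_assoc _ _ _)

/-- The reflection of `crossCup` in a horizontal line. -/
def crossCap : FrobHom ρ (dn q.ia ⬝ up q.ic ⬝ up q.cd) (up q.ad) :=
  hcomp (id (dn q.ia)) (cross q) (Quiver.Path.comp_assoc _ _ _) rfl ⊚
    hcomp (cap q.ia) (id (up q.ad)) (Quiver.Path.comp_assoc _ _ _).symm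
      (Quiver.Path.nil_comp _).symm

theorem cross_symm_vcomp_cross :
    cross q.symm ⊚ cross q = (id (up q.ia ⬝ up q.ad) : FrobHom ρ _ _) :=
  Quotient.sound (Rel.r2_easy q.symm)

theorem cup_poly_cap {s : B} (h : IsAdd I A s) (f : ρ.inv I) (h₁ : dn h = dn h ⬝ nil I)
    (h₂ : dn h ⬝ up h = dn h ⬝ up h) :
    cup h ⊚ hcomp (hcomp (id (dn h)) (poly f) h₁ h₁) (id (up h)) h₂ h₂ ⊚ cap h =
      poly (ρ.trace I A f) :=
  Quotient.sound (Rel.ccwCircle h f)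

/-- The right-facing crossing is a bent `crossCup`; in this form `close_turn` can undo the bend. The
content is only regrouping. -/
theorem mk_rightCross :
    mk (Diag.rightCross ρ q) = turnCap q.cd (P := up q.ad ⬝ dn q.cd) (crossCup q) rfl rfl := by
  have z₁ : dn q.ia ⬝ (up q.ia ⬝ up q.ad) ⬝ dn q.cd =
    dn q.ia ⬝ up q.ia ⬝ (up q.ad ⬝ dn q.cd) := by simp only [Quiver.Path.comp_assoc]
  have z₂ : up q.ad ⬝ dn q.cd = nil A ⬝ (up q.ad ⬝ dn q.cd) := (Quiver.Path.nil_comp _).symm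
  rw [turnCap, crossCup, vcomp_hcomp_id (hQ := rfl),
    hcomp_assoc (a := cup q.ia) (h₅ := rfl) (h₆ := rfl) (h₇ := z₂) (h₈ := z₁), id_hcomp_id rfl rfl]
  rfl

theorem mk_leftCross :
    mk (Diag.leftCross ρ q) = turnCup q.cd (P := up q.ad ⬝ dn q.cd) (crossCap q) rfl rfl := by
  have z₁ : dn q.ia ⬝ (up q.ia ⬝ up q.ad) ⬝ dn q.cd =
    dn q.ia ⬝ up q.ia ⬝ (up q.ad ⬝ dn q.cd) := by simp only [Quiver.Path.comp_assoc]
  have z₂ : up q.ad ⬝ dn q.cd = nil A ⬝ (up q.ad ⬝ dn q.cd) := (Quiver.Path.nil_comp _).symm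
  rw [turnCup, crossCap, vcomp_hcomp_id (hQ := rfl),
    hcomp_assoc (a := cap q.ia) (h₅ := rfl) (h₆ := rfl) (h₇ := z₁) (h₈ := z₂), id_hcomp_id rfl rfl,
    ← vcomp_assoc]
  rfl

/-- A counterclockwise circle crossing an upward strand can be pulled off to the left. -/
theorem crossCup_poly_crossCap (f : ρ.inv I) (h₀ : dn q.ia = dn q.ia ⬝ nil I)
    (h₁ : up q.ad = nil A ⬝ up q.ad) :
    crossCup q ⊚ hcomp (hcomp (hcomp (id (dn q.ia)) (poly f) h₀ h₀) (id (up q.ic)) rfl rfl)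
        (id (up q.cd)) rfl rfl ⊚ crossCap q =
      hcomp (poly (ρ.trace I A f)) (id (up q.ad)) h₁ h₁ := by
  have z₁ : dn q.ia ⬝ up q.ic ⬝ up q.cd = dn q.ia ⬝ (up q.ic ⬝ up q.cd) :=
    Quiver.Path.comp_assoc _ _ _
  have z₂ : dn q.ia ⬝ (up q.ia ⬝ up q.ad) = dn q.ia ⬝ up q.ia ⬝ up q.ad :=
    (Quiver.Path.comp_assoc _ _ _).symm
  -- The polynomial lies to the left of both crossings. It moves below them, after which they are
  -- adjacent and cancel by easy Reidemeister II.
  have e : hcomp (id (dn q.ia)) (cross q.symm) rfl z₁ ⊚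
      hcomp (hcomp (id (dn q.ia)) (poly f) h₀ h₀) (id (up q.ic ⬝ up q.cd)) z₁ z₁ ⊚
      hcomp (id (dn q.ia)) (cross q) z₁ rfl =
      hcomp (hcomp (id (dn q.ia)) (poly f) h₀ h₀) (id (up q.ia ⬝ up q.ad)) rfl rfl := by
    have e' := exchange (hcomp (id (dn q.ia)) (poly f) h₀ h₀) (cross q.symm) rfl rfl z₁ z₁
    refine (congrArg (· ⊚ _) e'.symm).trans ?_
    rw [vcomp_assoc, interchange, vcomp_id, cross_symm_vcomp_cross, id_hcomp_id rfl rfl, vcomp_id]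
  rw [hcomp_assoc (b := id (up q.ic)) (h₅ := rfl) (h₆ := rfl) (h₇ := z₁) (h₈ := z₁),
    id_hcomp_id rfl rfl, crossCup, crossCap]
  simp only [← vcomp_assoc]
  rw [vcomp_assoc (hcomp (cup _) _ _ _), vcomp_assoc (hcomp (cup _) _ _ _), e,
    ← id_hcomp_id (p := up q.ia) rfl rfl,
    ← hcomp_assoc (h₁ := rfl) (h₂ := rfl) (h₃ := z₂) (h₄ := z₂), ← vcomp_hcomp_id,
    ← vcomp_hcomp_id, cup_poly_cap]

/-- Two crossing strands with a polynomial in the region between them. -/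
def bigon (f : ρ.inv I) : FrobHom ρ (up q.ad ⬝ dn q.cd) (up q.ad ⬝ dn q.cd) :=
  mk (Diag.rightCross ρ q) ⊚ hcomp (hcomp (id (dn q.ia)) (poly f) (Quiver.Path.comp_nil _).symm
    (Quiver.Path.comp_nil _).symm) (id (up q.ic)) rfl rfl ⊚ mk (Diag.leftCross ρ q)

/-- Closing turns the downward strand into a counterclockwise circle that overlaps the upward one.
This circle pulls off to the left and evaluates to the trace. -/
theorem close_bigon (f : ρ.inv I) (h₁ : up q.ad = nil A ⬝ up q.ad) :
    close q.cd rfl (bigon q f) = hcomp (poly (ρ.trace I A f)) (id (up q.ad)) h₁ h₁ := by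
  rw [bigon, mk_rightCross, mk_leftCross, close_turn, crossCup_poly_crossCap]

/-- This is hard Reidemeister II with each summand cut between its two strands. The upward strand
and the trace can then be absorbed into a closure, while the downward strand and `d i` remain as
spectators on the right. -/
theorem bigon_eq_sum (f : ρ.inv I) {n : ℕ} (c d : Fin n → ρ.inv C) (hcd : ρ.IsDualBases C D c d)
    (h₁ : up q.ad = nil A ⬝ up q.ad) (h₂ : dn q.cd = dn q.cd ⬝ nil C) :
    bigon q f = ∑ i, hcomp (hcomp (poly (ρ.trace I A (f * incl ρ q.ic (c i)))) (id (up q.ad)) h₁ h₁)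
      (hcomp (id (dn q.cd)) (poly (d i)) h₂ h₂) rfl rfl := by
  have z₁ : up q.ad ⬝ dn q.cd = nil A ⬝ (up q.ad ⬝ dn q.cd) := (Quiver.Path.nil_comp _).symm
  have z₂ : up q.ad ⬝ dn q.cd = up q.ad ⬝ dn q.cd ⬝ nil C := (Quiver.Path.comp_nil _).symm
  have e : ∀ i, hcomp (hcomp (poly (ρ.trace I A (f * incl ρ q.ic (c i)))) (id (up q.ad)) h₁ h₁)
      (hcomp (id (dn q.cd)) (poly (d i)) h₂ h₂) rfl rfl =
      hcomp (hcomp (poly (ρ.trace I A (f * incl ρ q.ic (c i)))) (id (up q.ad ⬝ dn q.cd)) z₁ z₁)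
        (poly (d i)) z₂ z₂ := fun i => by
    rw [← hcomp_assoc (h₁ := rfl) (h₂ := rfl) (h₃ := z₂) (h₄ := z₂),
      hcomp_assoc (h₅ := rfl) (h₆ := rfl) (h₇ := z₁) (h₈ := z₁), id_hcomp_id rfl rfl]
  simp only [e]
  exact (Quotient.sound (Rel.r2_hard' q f c d hcd)).trans (mk_sum _)

end Crossings

/-! ### The nested circle diagram -/

section Circles

variable {S : FinSub cs} {u : ℕ → B}

theorem mk_circles {n : ℕ} (h : IsSeq S u (n + 1)) (g : ρ.inv (hat₂ S (u n) (u (n + 1))))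
    (h₁ : h.L' = h.L' ⬝ nil _) (h₂ : h.L = h.L' ⬝ up h.square.ic) :
    mk (h.circles ρ g) = mk (h.bottom ρ) ⊚
      hcomp (hcomp (id h.L') (poly g) h₁ h₁) (id (up h.square.ic)) h₂ h₂ ⊚ mk (h.top ρ) :=
  rfl

theorem mk_bottom_succ {n : ℕ} (h : IsSeq S u (n + 2)) {E : Expr (hat S (u 0)) S}
    {C : Expr (hat S (u 0)) (hat S (u (n + 2)))} (h₁ : up h.addZero = up h.addZero ⬝ nil S)
    (h₂ : E = up h.addZero ⬝ (dn h.prev.add ⬝ up h.prev.add)) (h₃ : C = E ⬝ dn h.add)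
    (h₄ : C = h.prev.K ⬝ (up h.square.ad ⬝ dn h.square.cd))
    (h₅ : h.L = h.prev.L ⬝ (dn h.square.ia ⬝ up h.square.ic))
    (h₆ : h.K = up h.addZero ⬝ dn h.add) :
    mk (h.bottom ρ) = hcomp (hcomp (id (up h.addZero)) (cup h.prev.add) h₁ h₂)
      (id (dn h.add)) h₆ h₃ ⊚
        hcomp (mk (h.prev.bottom ρ)) (mk (Diag.rightCross ρ h.square)) h₄ h₅ := by
  subst h₂ h₃
  rfl

/-- The level just below the final cap has two readings: `+u_0`, the legs of the cap, `-u_d`; or the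
previous `K` followed by the strands of the last bigon. Naming it `C` allows both. -/
theorem mk_top_succ {n : ℕ} (h : IsSeq S u (n + 2)) {E : Expr (hat S (u 0)) S}
    {C : Expr (hat S (u 0)) (hat S (u (n + 2)))} (h₁ : up h.addZero = up h.addZero ⬝ nil S)
    (h₂ : E = up h.addZero ⬝ (dn h.prev.add ⬝ up h.prev.add)) (h₃ : C = E ⬝ dn h.add)
    (h₄ : C = h.prev.K ⬝ (up h.square.ad ⬝ dn h.square.cd))
    (h₅ : h.L = h.prev.L ⬝ (dn h.square.ia ⬝ up h.square.ic))
    (h₆ : h.K = up h.addZero ⬝ dn h.add) :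
    mk (h.top ρ) =
        hcomp (mk (h.prev.top ρ)) (mk (Diag.leftCross ρ h.square)) h₅ h₄ ⊚
      hcomp (hcomp (id (up h.addZero)) (cap h.prev.add) h₂ h₁) (id (dn h.add)) h₃ h₆ := by
  subst h₂ h₃
  rfl

/-- The polynomial touches only the last bigon, so by the interchange law the middle of the diagram
splits into two independent columns. -/
theorem mk_circles_succ {n : ℕ} (h : IsSeq S u (n + 2))
    (g : ρ.inv (hat₂ S (u (n + 1)) (u (n + 2)))) {E : Expr (hat S (u 0)) S}
    {C : Expr (hat S (u 0)) (hat S (u (n + 2)))} (h₁ : up h.addZero = up h.addZero ⬝ nil S)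
    (h₂ : E = up h.addZero ⬝ (dn h.prev.add ⬝ up h.prev.add)) (h₃ : C = E ⬝ dn h.add)
    (h₄ : C = h.prev.K ⬝ (up h.square.ad ⬝ dn h.square.cd)) (h₆ : h.K = up h.addZero ⬝ dn h.add) :
    mk (h.circles ρ g) =
      hcomp (hcomp (id (up h.addZero)) (cup h.prev.add) h₁ h₂) (id (dn h.add)) h₆ h₃ ⊚
        hcomp (mk (h.prev.bottom ρ) ⊚ mk (h.prev.top ρ)) (bigon h.square g) h₄ h₄ ⊚
        hcomp (hcomp (id (up h.addZero)) (cap h.prev.add) h₂ h₁) (id (dn h.add)) h₃ h₆ := by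
  have z₁ : dn h.square.ia = dn h.square.ia ⬝ nil _ := (Quiver.Path.comp_nil _).symm
  have z₂ : h.L' = h.L' ⬝ nil _ := (Quiver.Path.comp_nil _).symm
  have z₃ : h.L' = h.prev.L ⬝ dn h.square.ia := rfl
  have z₄ : h.L = h.prev.L ⬝ (dn h.square.ia ⬝ up h.square.ic) := rfl
  have z₅ : h.L = h.L' ⬝ up h.square.ic := rfl
  rw [mk_circles h g z₂ z₅, mk_bottom_succ h h₁ h₂ h₃ h₄ z₄ h₆, mk_top_succ h h₁ h₂ h₃ h₄ z₄ h₆,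
    ← id_hcomp_id z₃ z₃, hcomp_assoc (h₅ := z₁) (h₆ := z₁) (h₇ := z₃) (h₈ := z₃),
    hcomp_assoc (h₅ := rfl) (h₆ := rfl) (h₇ := z₄) (h₈ := z₄), bigon]
  simp only [vcomp_assoc]
  rw [← vcomp_assoc (hcomp (mk (h.prev.bottom ρ)) _ _ _),
    ← vcomp_assoc (hcomp (mk (h.prev.bottom ρ)) _ _ _ ⊚ _), interchange, interchange, vcomp_id]
  simp only [vcomp_assoc]

/-- Closing the diagram of nested circles on the right evaluates it to a polynomial. -/
theorem close_mk_circles {n : ℕ} (h : IsSeq S u (n + 1))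
    (g : ρ.inv (hat₂ S (u n) (u (n + 1)))) (hK : h.K = up h.addZero ⬝ dn h.add)
    (h₁ : up h.addZero = nil _ ⬝ up h.addZero) :
    close h.add hK (mk (h.circles ρ g)) =
      hcomp (poly (exprOp ρ h.L' g)) (id (up h.addZero)) h₁ h₁ := by
  induction n with
  | zero => exact close_bigon h.square g h₁
  -- `close_conj` and `close_hcomp` confine the closure to the last bigon, whose value is then
  -- absorbed into a shorter closed diagram.
  | succ n ih =>
    have z₁ : up h.addZero = up h.addZero ⬝ nil S := (Quiver.Path.comp_nil _).symm
    have z₂ : h.prev.K = up h.addZero ⬝ dn h.prev.add := rfl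
    have z₃ : up h.square.ad = nil _ ⬝ up h.square.ad := (Quiver.Path.nil_comp _).symm
    have z₄ : h.prev.L' = h.prev.L' ⬝ nil _ := (Quiver.Path.comp_nil _).symm
    have z₅ : h.prev.L = h.prev.L' ⬝ up h.prev.square.ic := rfl
    have z₆ : up h.square.ad = up h.square.ad ⬝ nil S := (Quiver.Path.comp_nil _).symm
    obtain ⟨E, hE⟩ : ∃ E, E = up h.addZero ⬝ (dn h.prev.add ⬝ up h.prev.add) := ⟨_, rfl⟩
    obtain ⟨C, hC⟩ : ∃ C, C = E ⬝ dn h.add := ⟨_, rfl⟩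
    have z₇ : E = E ⬝ nil S := (Quiver.Path.comp_nil _).symm
    have z₈ : E = h.prev.K ⬝ up h.square.ad := hE
    have z₉ : C = h.prev.K ⬝ (up h.square.ad ⬝ dn h.square.cd) := by rw [hC, z₈]; rfl
    -- Here the strand `-u_d` has been closed away, so the spectator on the right is the empty
    -- diagram.
    have e := conj_cup_hcomp_poly h.prev.add h.prev.square.ic z₂ z₅ (mk (h.prev.bottom ρ))
      (mk (h.prev.top ρ)) (ρ.trace _ _ g) (id (nil S)) z₄ z₁ hE z₁ z₇ z₃ z₆ z₈
    rw [hcomp_nil, hcomp_nil, hcomp_nil, hcomp_nil, ← mk_circles h.prev _ z₄ z₅,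
      ih h.prev _ z₂ h₁] at e
    rw [mk_circles_succ h g z₁ hE hC z₉ hK, close_conj (hQ := hC),
      close_hcomp (hP := rfl) (hX := z₈), close_bigon h.square g z₃]
    -- Unfolding `exprOp` on the last two steps of `L'` gives the inclusion of the trace of `g`,
    -- which is the polynomial in `e`.
    exact e

/-- The diagram of nested circles in terms of dual bases. -/
theorem mk_circles_eq_sum {n : ℕ} (h : IsSeq S u (n + 1))
    (g : ρ.inv (hat₂ S (u n) (u (n + 1)))) {N : ℕ} (c d : Fin N → ρ.inv (hat S (u (n + 1))))
    (hcd : ρ.IsDualBases (hat S (u (n + 1))) S c d) (hK : h.K = up h.addZero ⬝ dn h.add)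
    (h₁ : up h.addZero = nil _ ⬝ up h.addZero) (h₂ : dn h.add = dn h.add ⬝ nil _) :
    mk (h.circles ρ g) = ∑ i, hcomp (hcomp (poly (exprOp ρ h.L' (g * incl ρ h.square.ic (c i))))
      (id (up h.addZero)) h₁ h₁) (hcomp (id (dn h.add)) (poly (d i)) h₂ h₂) hK hK := by
  cases n with
  | zero => exact bigon_eq_sum h.square g c d hcd h₁ h₂
  | succ n =>
    have z₁ : up h.addZero = up h.addZero ⬝ nil S := (Quiver.Path.comp_nil _).symm
    have z₂ : h.prev.K = up h.addZero ⬝ dn h.prev.add := rfl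
    have z₃ : up h.square.ad = nil _ ⬝ up h.square.ad := (Quiver.Path.nil_comp _).symm
    have z₄ : h.prev.L' = h.prev.L' ⬝ nil _ := (Quiver.Path.comp_nil _).symm
    have z₅ : h.prev.L = h.prev.L' ⬝ up h.prev.square.ic := rfl
    obtain ⟨E, hE⟩ : ∃ E, E = up h.addZero ⬝ (dn h.prev.add ⬝ up h.prev.add) := ⟨_, rfl⟩
    obtain ⟨C, hC⟩ : ∃ C, C = E ⬝ dn h.add := ⟨_, rfl⟩
    have z₈ : E = h.prev.K ⬝ up h.square.ad := hE
    have z₉ : C = h.prev.K ⬝ (up h.square.ad ⬝ dn h.square.cd) := by rw [hC, z₈]; rfl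
    rw [mk_circles_succ h g z₁ hE hC z₉ hK, bigon_eq_sum h.square g c d hcd z₃ h₂, hcomp_sum,
      vcomp_sum, sum_vcomp]
    refine Finset.sum_congr rfl fun i _ => ?_
    -- Now the spectator is the strand `-u_d` with `d i` on its right; the rest of the summand is
    -- the closure of the previous diagram.
    have e := conj_cup_hcomp_poly h.prev.add h.prev.square.ic z₂ z₅ (mk (h.prev.bottom ρ))
      (mk (h.prev.top ρ)) (ρ.trace _ _ (g * incl ρ h.square.ic (c i)))
      (hcomp (id (dn h.add)) (poly (d i)) h₂ h₂) z₄ z₁ hE hK hC z₃ rfl z₉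
    rw [← mk_circles h.prev _ z₄ z₅, close_mk_circles h.prev _ z₂ h₁] at e
    exact e

end Circles

end FrobHom

end SoergelCalculus

theorem mainTheorem10 {B W : Type*} [Group W] {M : CoxeterMatrix B} (cs : CoxeterSystem M W)
    {k V : Type*} [Field k] [AddCommGroup V] [Module k V] [FiniteDimensional k V]
    (ρ : Realization cs k V) (hfaithful : ρ.Faithful) (hbalanced : ρ.Balanced)
    (hsurj : ρ.GeneralizedDemazureSurjectivity) (hrefl : ρ.ReflectionFaithful)
    (S : FinSub cs) (u : ℕ → B) (n : ℕ) (hn : 2 ≤ n + 1) (h : IsSeq S u (n + 1))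
    (g : ρ.inv (hat₂ S (u n) (u (n + 1))))
    {N : ℕ} (c d : Fin N → ρ.inv (hat S (u (n + 1))))
    (hcd : ρ.IsDualBases (hat S (u (n + 1))) S c d) :
    FrobHom.mk (h.circles ρ g) =
      FrobHom.mk (Diag.sum fun i =>
        h.idWithPolys ρ (exprOp ρ h.L' (g * incl ρ h.square.ic (c i))) (d i)) := by
  have z₁ : h.K = (nil _).comp h.K := (Quiver.Path.nil_comp _).symm
  have z₂ : h.K = h.K.comp (nil _) := (Quiver.Path.comp_nil _).symm
  have z₃ : h.K = (up h.addZero).comp (dn h.add) := rfl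
  have z₄ : up h.addZero = (nil _).comp (up h.addZero) := (Quiver.Path.nil_comp _).symm
  have z₅ : dn h.add = (dn h.add).comp (nil _) := (Quiver.Path.comp_nil _).symm
  rw [FrobHom.mk_circles_eq_sum h g c d hcd z₃ z₄ z₅, FrobHom.mk_sum]
  refine Finset.sum_congr rfl fun i _ => ?_
  -- Each summand was cut between its two strands; regrouping joins them into the identity of `K`.
  rw [← FrobHom.hcomp_assoc (h₁ := z₃) (h₂ := z₃) (h₃ := z₂) (h₄ := z₂),
    FrobHom.hcomp_assoc (h₅ := z₃) (h₆ := z₃) (h₇ := z₁) (h₈ := z₁), FrobHom.id_hcomp_id z₃ z₃]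
  rfl
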